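/- Let $\mathcal C$ be a braided monoidal category with braiding $\beta_{X,Y}:X\otimes Y\to Y\otimes X$, and let $\mathcal M$ be a preadditive category with the structure of a left module category over $\mathcal C$ such that each functor $X\otimes -:\mathcal M\to\mathcal M$ is additive. (No semisimplicity, rigidity or finiteness is needed.) Let $\mathcal C^*$ be the category of additive module functors $F:\mathcal M\to\mathcal M$, with natural structure morphisms $c^F_{X,m}:F(X\otimes m)\to X\otimes F(m)$ compatible with associativity and unit, and with natural transformations commuting with the $c_{X,m}$ as morphisms; it is monoidal under composition $F\circ G$. For $X\in\mathcal C$ let $\alpha^{+}(X)$, resp. $\alpha^-(X)$, be the functor $X\otimes -$ with the module functor structure $c_{Y,m}=\beta_{X,Y}\otimes\mathrm{id}_m$, resp. $c_{Y,m}=\beta_{Y,X}^{-1}\otimes\mathrm{id}_m$ (up to associativity isomorphisms). Let $\mathcal C^*_\pm\subset\mathcal C^*$ be the full subcategory of all direct summands (retracts) of the objects $\alpha^\pm(X)$, $X\in\mathcal C$; if $\mathcal C^*$ is semisimple abelian these are the same as the subquotients of the $\alpha^\pm(X)$. Then $\mathcal C^*_+$ and $\mathcal C^*_-$ are monoidal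 subcategories of $\mathcal C^*$, and there is a unique family of isomorphisms in $\mathcal C^*$ $$\beta^*_{F,G}:F\circ G\to G\circ F,\qquad F\in\mathcal C^*_+,\ G\in\mathcal C^*_-,$$ natural in $F$ and in $G$ with respect to all morphisms of $\mathcal C^*_+$ and of $\mathcal C^*_-$, such that for all $X,Y\in\mathcal C$ and $m\in\mathcal M$ the component of $\beta^*_{\alpha^+(X),\alpha^-(Y)}$ at $m$ is $\beta_{X,Y}\otimes\mathrm{id}_m:X\otimes (Y\otimes m)\to Y\otimes (X\otimes m)$ (up to associativity isomorphisms). The family $\beta^*$ satisfies both hexagon identities, i.e. it is multiplicative in $F\in\mathcal C^*_+$ and in $G\in\mathcal C^*_-$. In particular $\mathcal C^*_0:=\mathcal C^*_+\cap\mathcal C^*_-$ is a monoidal subcategory of $\mathcal C^*$, and it is a braided category with braiding $\beta^*_{F,G}$, $F,G\in\mathcal C^*_0$. -/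

import Mathlib

open CategoryTheory MonoidalCategory
open scoped MonoidalLeftAction

universe v₁ v₂ u₁ u₂

/-- An additive module endofunctor of a left module category `M` over a monoidal category `C`:
an additive functor `F : M ⥤ M` with natural morphisms
`c_{X,m} : F (X ⊙ₗ m) ⟶ X ⊙ₗ F m` compatible with the associativity and unit isomorphisms of
the module category. -/
structure ModEnd (C : Type u₁) [Category.{v₁} C] [MonoidalCategory C]
    (M : Type u₂) [Category.{v₂} M] [Preadditive M] [MonoidalLeftAction C M] where
  /-- the underlying functor -/
  functor : M ⥤ M
  /-- the underlying functor is additive -/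
  additive : functor.Additive
  /-- the module functor structure -/
  linear : functor.OplaxLeftLinear C

namespace ModEnd

section

variable {C : Type u₁} [Category.{v₁} C] [MonoidalCategory C]
  {M : Type u₂} [Category.{v₂} M] [Preadditive M] [MonoidalLeftAction C M]

/-- The structure morphism `c_{X,m} : F (X ⊙ₗ m) ⟶ X ⊙ₗ F m` of a module functor. -/
def c (F : ModEnd C M) (X : C) (m : M) :
    F.functor.obj (X ⊙ₗ m) ⟶ X ⊙ₗ F.functor.obj m :=
  letI := F.linear
  Functor.OplaxLeftLinear.δₗ F.functor X m

theorem c_naturality_left (F : ModEnd C M) {X Y : C} (f : X ⟶ Y) (m : M) :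
    F.functor.map (f ⊵ₗ m) ≫ F.c Y m = F.c X m ≫ f ⊵ₗ F.functor.obj m :=
  letI := F.linear
  Functor.OplaxLeftLinear.δₗ_naturality_left F.functor f m

theorem c_naturality_right (F : ModEnd C M) (X : C) {m n : M} (f : m ⟶ n) :
    F.functor.map (X ⊴ₗ f) ≫ F.c X n = F.c X m ≫ X ⊴ₗ F.functor.map f :=
  letI := F.linear
  Functor.OplaxLeftLinear.δₗ_naturality_right F.functor X f

theorem c_associativity (F : ModEnd C M) (X Y : C) (m : M) :
    F.c (X ⊗ Y) m ≫ (αₗ X Y (F.functor.obj m)).hom =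
      F.functor.map (αₗ X Y m).hom ≫ F.c X (Y ⊙ₗ m) ≫ X ⊴ₗ F.c Y m :=
  letI := F.linear
  Functor.OplaxLeftLinear.δₗ_associativity F.functor X Y m

theorem c_unitality (F : ModEnd C M) (m : M) :
    F.functor.map (λₗ[C] m).inv ≫ F.c (𝟙_ C) m = (λₗ[C] (F.functor.obj m)).inv :=
  letI := F.linear
  (Functor.OplaxLeftLinear.δₗ_unitality_inv F.functor m).symm

/-- A morphism of module functors: a natural transformation commuting with the structure
morphisms. -/
@[ext]
structure Hom (F G : ModEnd C M) where
  /-- the underlying natural transformation -/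
  trans : F.functor ⟶ G.functor
  comm (X : C) (m : M) :
    F.c X m ≫ X ⊴ₗ trans.app m = trans.app (X ⊙ₗ m) ≫ G.c X m

/-- The category `C*` of module endofunctors of `M`. -/
instance category : Category (ModEnd C M) where
  Hom F G := Hom F G
  id F := { trans := 𝟙 _, comm := by simp }
  comp φ ψ :=
    { trans := φ.trans ≫ ψ.trans
      comm := fun X m => by
        simp only [NatTrans.comp_app, MonoidalLeftAction.actionHomRight_comp, Category.assoc]
        rw [← ψ.comm, ← Category.assoc, φ.comm, Category.assoc] }
  id_comp φ := Hom.ext (Category.id_comp _)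
  comp_id φ := Hom.ext (Category.comp_id _)
  assoc φ ψ χ := Hom.ext (Category.assoc _ _ _)

theorem hom_ext {F G : ModEnd C M} {φ ψ : F ⟶ G} (h : ∀ m, φ.trans.app m = ψ.trans.app m) :
    φ = ψ :=
  Hom.ext (NatTrans.ext (funext h))

@[simp]
theorem id_app (F : ModEnd C M) (m : M) :
    (Hom.trans (𝟙 F)).app m = 𝟙 (F.functor.obj m) := rfl

@[simp]
theorem comp_app {F G H : ModEnd C M} (φ : F ⟶ G) (ψ : G ⟶ H) (m : M) :
    (Hom.trans (φ ≫ ψ)).app m = φ.trans.app m ≫ ψ.trans.app m := rfl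

/-- The identity module functor. -/
def one : ModEnd C M where
  functor := 𝟭 M
  additive := inferInstance
  linear := { δₗ := fun _ _ => 𝟙 _ }

/-- The composition `F ∘ G` (first `G`, then `F`) of module functors. -/
def comp (F G : ModEnd C M) : ModEnd C M where
  functor := G.functor ⋙ F.functor
  additive :=
    letI := F.additive
    letI := G.additive
    inferInstance
  linear :=
    { δₗ := fun X m => F.functor.map (G.c X m) ≫ F.c X (G.functor.obj m)
      δₗ_naturality_left := fun f m => by
        dsimp only [Functor.comp_obj, Functor.comp_map]
        rw [← Functor.map_comp_assoc, c_naturality_left, Functor.map_comp, Category.assoc,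
          c_naturality_left, Category.assoc]
      δₗ_naturality_right := fun X _ _ f => by
        dsimp only [Functor.comp_obj, Functor.comp_map]
        rw [← Functor.map_comp_assoc, c_naturality_right, Functor.map_comp, Category.assoc,
          c_naturality_right, Category.assoc]
      δₗ_associativity := fun X Y m => by
        dsimp only [Functor.comp_obj, Functor.comp_map]
        rw [Category.assoc, c_associativity, ← Functor.map_comp_assoc, c_associativity]
        simp only [Functor.map_comp, Category.assoc, MonoidalLeftAction.actionHomRight_comp]
        rw [← Category.assoc (F.functor.map (X ⊴ₗ G.c Y m)), c_naturality_right, Category.assoc]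
      δₗ_unitality_inv := fun m => by
        dsimp only [Functor.comp_obj, Functor.comp_map]
        rw [← Functor.map_comp_assoc, c_unitality, c_unitality] }

/-- A natural isomorphism with components commuting with the structure morphisms is an isomorphism
of module functors. -/
def mkIso {F G : ModEnd C M} (e : F.functor ≅ G.functor)
    (h : ∀ (X : C) (m : M),
      F.c X m ≫ X ⊴ₗ e.hom.app m = e.hom.app (X ⊙ₗ m) ≫ G.c X m) : F ≅ G where
  hom := { trans := e.hom, comm := h }
  inv :=
    { trans := e.inv
      comm := fun X m => by
        have h1 := congrArg (fun t => e.inv.app (X ⊙ₗ m) ≫ t ≫ X ⊴ₗ e.inv.app m) (h X m)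
        simpa [← MonoidalLeftAction.actionHomRight_comp] using h1.symm }
  hom_inv_id := Hom.ext e.hom_inv_id
  inv_hom_id := Hom.ext e.inv_hom_id

/-- The data of the monoidal structure on `C*` given by composition of module functors:
`F ⊗ G = F ∘ G`, with trivial associativity and unit isomorphisms. -/
instance monoidalCategoryStruct : MonoidalCategoryStruct (ModEnd C M) where
  tensorObj F G := comp F G
  tensorUnit := one
  whiskerLeft F G G' ψ :=
    { trans := Functor.whiskerRight ψ.trans F.functor
      comm := fun X m => by
        change (F.functor.map (G.c X m) ≫ F.c X (G.functor.obj m)) ≫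
            X ⊴ₗ F.functor.map (ψ.trans.app m) =
          F.functor.map (ψ.trans.app (X ⊙ₗ m)) ≫
            F.functor.map (G'.c X m) ≫ F.c X (G'.functor.obj m)
        rw [Category.assoc, ← c_naturality_right, ← Functor.map_comp_assoc,
          ← Functor.map_comp_assoc, ψ.comm] }
  whiskerRight {F F'} φ G :=
    { trans := Functor.whiskerLeft G.functor φ.trans
      comm := fun X m => by
        change (F.functor.map (G.c X m) ≫ F.c X (G.functor.obj m)) ≫
            X ⊴ₗ φ.trans.app (G.functor.obj m) =
          φ.trans.app (G.functor.obj (X ⊙ₗ m)) ≫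
            F'.functor.map (G.c X m) ≫ F'.c X (G.functor.obj m)
        rw [Category.assoc, φ.comm, NatTrans.naturality_assoc] }
  associator F G H := mkIso (Iso.refl (H.functor ⋙ G.functor ⋙ F.functor)) fun X m => by
    change (F.functor.map (G.functor.map (H.c X m)) ≫ F.functor.map (G.c X (H.functor.obj m)) ≫
        F.c X (G.functor.obj (H.functor.obj m))) ≫ X ⊴ₗ 𝟙 _ =
      𝟙 _ ≫ F.functor.map (G.functor.map (H.c X m) ≫ G.c X (H.functor.obj m)) ≫
        F.c X (G.functor.obj (H.functor.obj m))
    simp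
  leftUnitor F := mkIso (Iso.refl F.functor) fun X m => by
    change (F.c X m ≫ 𝟙 _) ≫ X ⊴ₗ 𝟙 _ = 𝟙 _ ≫ F.c X m
    simp
  rightUnitor F := mkIso (Iso.refl F.functor) fun X m => by
    change (F.functor.map (𝟙 _) ≫ F.c X m) ≫ X ⊴ₗ 𝟙 _ = 𝟙 _ ≫ F.c X m
    simp

@[simp]
theorem whiskerLeft_app (F : ModEnd C M) {G G' : ModEnd C M} (ψ : G ⟶ G') (m : M) :
    (Hom.trans (F ◁ ψ)).app m = F.functor.map (ψ.trans.app m) := rfl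

@[simp]
theorem whiskerRight_app {F F' : ModEnd C M} (φ : F ⟶ F') (G : ModEnd C M) (m : M) :
    (Hom.trans (φ ▷ G)).app m = φ.trans.app (G.functor.obj m) := rfl

@[simp]
theorem tensorHom_app {F F' G G' : ModEnd C M} (φ : F ⟶ F') (ψ : G ⟶ G') (m : M) :
    (Hom.trans (φ ⊗ₘ ψ)).app m =
      φ.trans.app (G.functor.obj m) ≫ F'.functor.map (ψ.trans.app m) := rfl

@[simp]
theorem associator_hom_app (F G H : ModEnd C M) (m : M) :
    (Hom.trans (α_ F G H).hom).app m =
      𝟙 (F.functor.obj (G.functor.obj (H.functor.obj m))) := rfl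

@[simp]
theorem leftUnitor_hom_app (F : ModEnd C M) (m : M) :
    (Hom.trans (λ_ F).hom).app m = 𝟙 (F.functor.obj m) := rfl

@[simp]
theorem rightUnitor_hom_app (F : ModEnd C M) (m : M) :
    (Hom.trans (ρ_ F).hom).app m = 𝟙 (F.functor.obj m) := rfl

@[simp]
theorem tensorObj_obj (F G : ModEnd C M) (m : M) :
    (F ⊗ G).functor.obj m = F.functor.obj (G.functor.obj m) := rfl

@[simp]
theorem tensorObj_map (F G : ModEnd C M) {m n : M} (f : m ⟶ n) :
    (F ⊗ G).functor.map f = F.functor.map (G.functor.map f) := rfl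

@[simp]
theorem tensorUnit_obj (m : M) : (𝟙_ (ModEnd C M)).functor.obj m = m := rfl

@[simp]
theorem tensorUnit_map {m n : M} (f : m ⟶ n) : (𝟙_ (ModEnd C M)).functor.map f = f := rfl

/-- `C*` is a monoidal category under composition of module functors. -/
instance monoidalCategory : MonoidalCategory (ModEnd C M) where
  tensorHom_def _ _ := rfl
  id_tensorHom_id F G := hom_ext fun m => by simp
  tensorHom_comp_tensorHom _ _ _ _ := hom_ext fun m => by simp
  whiskerLeft_id _ _ := hom_ext fun m => by simp
  id_whiskerRight _ _ := hom_ext fun m => by simp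
  associator_naturality _ _ _ := hom_ext fun m => by simp
  leftUnitor_naturality _ := hom_ext fun m => by simp
  rightUnitor_naturality _ := hom_ext fun m => by simp
  pentagon _ _ _ _ := hom_ext fun m => by simp
  triangle _ _ := hom_ext fun m => by simp

end

section Alpha

variable {C : Type u₁} [Category.{v₁} C] [MonoidalCategory C]
  (M : Type u₂) [Category.{v₂} M] [Preadditive M] [MonoidalLeftAction C M]
  [∀ X : C, ((MonoidalLeftAction.curriedAction C M).obj X).Additive]

/-- For a braiding `b` on `C` and `X : C`, the functor `X ⊙ₗ -` with module functor structure
`b_{X,Y} ⊙ₗ m : X ⊙ₗ Y ⊙ₗ m ⟶ Y ⊙ₗ X ⊙ₗ m` (up to associativity isomorphisms). -/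
def alphaObj (b : BraidedCategory C) (X : C) : ModEnd C M where
  functor := (MonoidalLeftAction.curriedAction C M).obj X
  additive := inferInstance
  linear :=
    { δₗ := fun Y m => (αₗ X Y m).inv ≫ (b.braiding X Y).hom ⊵ₗ m ≫ (αₗ Y X m).hom
      δₗ_naturality_left := fun {Y Z} f m => by
        change X ⊴ₗ f ⊵ₗ m ≫ (αₗ X Z m).inv ≫ (b.braiding X Z).hom ⊵ₗ m ≫ (αₗ Z X m).hom =
          ((αₗ X Y m).inv ≫ (b.braiding X Y).hom ⊵ₗ m ≫ (αₗ Y X m).hom) ≫ f ⊵ₗ (X ⊙ₗ m)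
        have h := congrArg (fun t => (αₗ X Y m).inv ≫ t ⊵ₗ m ≫ (αₗ Z X m).hom)
          (b.braiding_naturality_right X f)
        simp only [MonoidalLeftAction.comp_actionHomLeft,
          MonoidalLeftAction.whiskerLeft_actionHomLeft, Category.assoc,
          Iso.inv_hom_id_assoc] at h
        rw [h]
        simp
      δₗ_naturality_right := fun Y m n f => by
        change X ⊴ₗ Y ⊴ₗ f ≫ (αₗ X Y n).inv ≫ (b.braiding X Y).hom ⊵ₗ n ≫ (αₗ Y X n).hom =
          ((αₗ X Y m).inv ≫ (b.braiding X Y).hom ⊵ₗ m ≫ (αₗ Y X m).hom) ≫ Y ⊴ₗ X ⊴ₗ f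
        have h := MonoidalLeftAction.action_exchange (b.braiding X Y).hom f
        simp only [MonoidalLeftAction.tensor_actionHomRight, Category.assoc] at h
        have h' := congrArg (fun t => (αₗ X Y m).inv ≫ t ≫ (αₗ Y X n).hom) h
        simpa using h'
      δₗ_associativity := fun Y Z m => by
        change ((αₗ X (Y ⊗ Z) m).inv ≫ (b.braiding X (Y ⊗ Z)).hom ⊵ₗ m ≫
            (αₗ (Y ⊗ Z) X m).hom) ≫ (αₗ Y Z (X ⊙ₗ m)).hom =
          X ⊴ₗ (αₗ Y Z m).hom ≫
            ((αₗ X Y (Z ⊙ₗ m)).inv ≫ (b.braiding X Y).hom ⊵ₗ (Z ⊙ₗ m) ≫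
              (αₗ Y X (Z ⊙ₗ m)).hom) ≫
            Y ⊴ₗ ((αₗ X Z m).inv ≫ (b.braiding X Z).hom ⊵ₗ m ≫ (αₗ Z X m).hom)
        have h0 (U V W : C) : (α_ U V W).inv ⊵ₗ m ≫ (αₗ (U ⊗ V) W m).hom ≫
            (αₗ U V (W ⊙ₗ m)).hom = (αₗ U (V ⊗ W) m).hom ≫ U ⊴ₗ (αₗ V W m).hom := by
          rw [← cancel_epi ((α_ U V W).hom ⊵ₗ m), MonoidalLeftAction.associator_actionHom,
            MonoidalLeftAction.hom_inv_actionHomLeft_assoc]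
        have h1 : (αₗ X (Y ⊗ Z) m).inv ≫ (α_ X Y Z).inv ⊵ₗ m =
            X ⊴ₗ (αₗ Y Z m).hom ≫ (αₗ X Y (Z ⊙ₗ m)).inv ≫ (αₗ (X ⊗ Y) Z m).inv := by
          rw [← cancel_mono ((αₗ (X ⊗ Y) Z m).hom ≫ (αₗ X Y (Z ⊙ₗ m)).hom)]
          simp [h0]
        have h2 : (α_ Y X Z).hom ⊵ₗ m ≫ (αₗ Y (X ⊗ Z) m).hom =
            (αₗ (Y ⊗ X) Z m).hom ≫ (αₗ Y X (Z ⊙ₗ m)).hom ≫ Y ⊴ₗ (αₗ X Z m).inv := by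
          rw [← cancel_mono (Y ⊴ₗ (αₗ X Z m).hom)]
          simp
        have h3 : (αₗ Y (Z ⊗ X) m).inv ≫ (α_ Y Z X).inv ⊵ₗ m ≫ (αₗ (Y ⊗ Z) X m).hom ≫
            (αₗ Y Z (X ⊙ₗ m)).hom = Y ⊴ₗ (αₗ Z X m).hom := by
          rw [h0, Iso.inv_hom_id_assoc]
        simp only [BraidedCategory.braiding_tensor_right_hom,
          MonoidalLeftAction.comp_actionHomLeft, MonoidalLeftAction.whiskerLeft_actionHomLeft,
          MonoidalLeftAction.actionHomLeft_action, MonoidalLeftAction.actionHomRight_comp,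
          Category.assoc]
        rw [h3]
        slice_lhs 1 2 => rw [h1]
        slice_lhs 5 6 => rw [h2]
        simp only [Category.assoc]
      δₗ_unitality_inv := fun m => by
        change (λₗ[C] (X ⊙ₗ m)).inv = X ⊴ₗ (λₗ[C] m).inv ≫
          (αₗ X (𝟙_ C) m).inv ≫ (b.braiding X (𝟙_ C)).hom ⊵ₗ m ≫ (αₗ (𝟙_ C) X m).hom
        rw [← cancel_mono (λₗ[C] (X ⊙ₗ m)).hom]
        have h := MonoidalLeftAction.leftUnitor_actionHom X m
        simp only [braiding_tensorUnit_right, Category.assoc,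
          MonoidalLeftAction.comp_actionHomLeft, MonoidalLeftAction.rightUnitor_actionHom]
        rw [← h]
        simp only [Iso.inv_hom_id, MonoidalLeftAction.inv_hom_actionHomLeft,
          Iso.inv_hom_id_assoc, MonoidalLeftAction.actionHomRight_inv_hom_assoc] }

/-- The functor `X ↦ (X ⊙ₗ -, b_{X,-})` from `C` to `C*`, for a braiding `b` on `C`. -/
def alpha (b : BraidedCategory C) : C ⥤ ModEnd C M where
  obj X := alphaObj M b X
  map {X Y} f :=
    { trans := (MonoidalLeftAction.curriedAction C M).map f
      comm := fun Z m => by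
        change ((αₗ X Z m).inv ≫ (b.braiding X Z).hom ⊵ₗ m ≫ (αₗ Z X m).hom) ≫ Z ⊴ₗ f ⊵ₗ m =
          f ⊵ₗ (Z ⊙ₗ m) ≫ (αₗ Y Z m).inv ≫ (b.braiding Y Z).hom ⊵ₗ m ≫ (αₗ Z Y m).hom
        have h := congrArg (fun t => (αₗ X Z m).inv ≫ t ⊵ₗ m ≫ (αₗ Z Y m).hom)
          (b.braiding_naturality_left f Z)
        simp only [MonoidalLeftAction.comp_actionHomLeft,
          MonoidalLeftAction.whiskerLeft_actionHomLeft, Category.assoc,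
          Iso.inv_hom_id, Category.comp_id] at h
        simp [h] }
  map_id X := hom_ext fun m => MonoidalLeftAction.id_actionHomLeft X m
  map_comp f g := hom_ext fun m => MonoidalLeftAction.comp_actionHomLeft f g m

variable (C) in
/-- `α⁺ : C ⥤ C*`, where `α⁺ X = X ⊙ₗ -` has module functor structure given by the braiding
`β_{X,Y}`. -/
abbrev alphaPlus [b : BraidedCategory C] : C ⥤ ModEnd C M := alpha M b

variable (C) in
/-- `α⁻ : C ⥤ C*`, where `α⁻ X = X ⊙ₗ -` has module functor structure given by the opposite
braiding `(β_{Y,X})⁻¹ : X ⊗ Y ⟶ Y ⊗ X`. -/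
abbrev alphaMinus [BraidedCategory C] : C ⥤ ModEnd C M := alpha M (reverseBraiding C)

variable (C) in
/-- The objects of `C*₊`: the direct summands of the module functors `α⁺ X`, `X : C`. -/
def plus [BraidedCategory C] : ObjectProperty (ModEnd C M) :=
  fun F => ∃ X : C, Nonempty (Retract F ((alphaPlus C M).obj X))

variable (C) in
/-- The objects of `C*₋`: the direct summands of the module functors `α⁻ X`, `X : C`. -/
def minus [BraidedCategory C] : ObjectProperty (ModEnd C M) :=
  fun F => ∃ X : C, Nonempty (Retract F ((alphaMinus C M).obj X))

theorem plus_alphaPlus [BraidedCategory C] (X : C) : plus C M ((alphaPlus C M).obj X) :=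
  ⟨X, ⟨Retract.refl _⟩⟩

theorem minus_alphaMinus [BraidedCategory C] (X : C) : minus C M ((alphaMinus C M).obj X) :=
  ⟨X, ⟨Retract.refl _⟩⟩

end Alpha

end ModEnd

/-- A functorial family of isomorphisms `F ⊗ G ≅ G ⊗ F`, where `F` and `G` run over the full
subcategories of a monoidal category given by `P` and `Q`. -/
@[ext]
structure RelativeBraiding {D : Type u₁} [Category.{v₁} D] [MonoidalCategory D]
    (P Q : ObjectProperty D) where
  /-- the isomorphisms -/
  iso {F G : D} (hF : P F) (hG : Q G) : F ⊗ G ≅ G ⊗ F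
  naturality_left {F F' G : D} (hF : P F) (hF' : P F') (hG : Q G) (φ : F ⟶ F') :
    φ ▷ G ≫ (iso hF' hG).hom = (iso hF hG).hom ≫ G ◁ φ
  naturality_right {F G G' : D} (hF : P F) (hG : Q G) (hG' : Q G') (ψ : G ⟶ G') :
    F ◁ ψ ≫ (iso hF hG').hom = (iso hF hG).hom ≫ ψ ▷ F

/-- The hexagon identities for a relative braiding: it is multiplicative in both variables. -/
structure RelativeBraiding.IsMultiplicative {D : Type u₁} [Category.{v₁} D] [MonoidalCategory D]
    {P Q : ObjectProperty D} (b : RelativeBraiding P Q) : Prop where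
  hexagon_forward {F G G' : D} (hF : P F) (hG : Q G) (hG' : Q G') (hGG' : Q (G ⊗ G')) :
    (α_ F G G').hom ≫ (b.iso hF hGG').hom ≫ (α_ G G' F).hom =
      (b.iso hF hG).hom ▷ G' ≫ (α_ G F G').hom ≫ G ◁ (b.iso hF hG').hom
  hexagon_reverse {F F' G : D} (hF : P F) (hF' : P F') (hFF' : P (F ⊗ F')) (hG : Q G) :
    (α_ F F' G).inv ≫ (b.iso hFF' hG).hom ≫ (α_ G F F').inv =
      F ◁ (b.iso hF' hG).hom ≫ (α_ F G F').inv ≫ (b.iso hF hG).hom ▷ F'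

/-- A relative braiding between `C*₊` and `C*₋` extends the braiding of `C` if
`α⁺ X ∘ α⁻ Y ≅ α⁻ Y ∘ α⁺ X` is given by `β_{X,Y} ⊙ₗ m : X ⊙ₗ Y ⊙ₗ m ⟶ Y ⊙ₗ X ⊙ₗ m`
(up to associativity isomorphisms). -/
def RelativeBraiding.Extends {C : Type u₁} [Category.{v₁} C] [MonoidalCategory C]
    [BraidedCategory C] {M : Type u₂} [Category.{v₂} M] [Preadditive M] [MonoidalLeftAction C M]
    [∀ X : C, ((MonoidalLeftAction.curriedAction C M).obj X).Additive]
    (b : RelativeBraiding (ModEnd.plus C M) (ModEnd.minus C M)) : Prop :=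
  ∀ (X Y : C) (m : M),
    (b.iso (ModEnd.plus_alphaPlus M X) (ModEnd.minus_alphaMinus M Y)).hom.trans.app m =
      (αₗ X Y m).inv ≫ (β_ X Y).hom ⊵ₗ m ≫ (αₗ Y X m).hom

/-! The half-braiding of `F` with `α⁻ Y` is the structure morphism `c^F_{Y,m} : F (Y ⊙ₗ m) ⟶ Y ⊙ₗ F
m` itself. It is always a morphism of module functors (`structureHom`), natural in `F` by the
definition of morphisms in `C*`. For `F` in `C*₊` it is invertible, since this holds for `α⁺ X` and
passes to retracts.

The main point is naturality with respect to every morphism `ψ : α⁻ Y ⟶ α⁻ Z` of `C*`, not only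
those coming from `C`. For `F = α⁺ X`, `c^F_{Y,m}` is `β_{X,Y}`, the inverse of the structure
morphism of `α⁻ Y` at `X`, so naturality is the compatibility of `ψ` with structure morphisms
(`whiskerLeft_structureHom_alphaPlus`). Naturality in `F` carries this over to retracts
(`whiskerLeft_structureHom`).

The family then extends to retracts of `α⁻ Y` by compression with `i` and `r` (`crossing`). One
hexagon is the formula for `c` on a composite, the other the associativity axiom of `c`. Uniqueness
holds because naturality determines the value on retracts. -/

namespace ModEnd

/-! ### Retracts of module functors and invertibility of structure morphisms -/

section

variable {C : Type u₁} [Category.{v₁} C] [MonoidalCategory C]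
  {M : Type u₂} [Category.{v₂} M] [Preadditive M] [MonoidalLeftAction C M]

theorem retract_app {F G : ModEnd C M} (h : Retract F G) (m : M) :
    h.i.trans.app m ≫ h.r.trans.app m = 𝟙 (F.functor.obj m) := by
  rw [← comp_app, h.retract, id_app]

omit [Preadditive M] in
theorem actionHomLeft_associator_inv (U V W : C) (m : M) :
    (α_ U V W).inv ⊵ₗ m ≫ (αₗ (U ⊗ V) W m).hom ≫ (αₗ U V (W ⊙ₗ m)).hom =
      (αₗ U (V ⊗ W) m).hom ≫ U ⊴ₗ (αₗ V W m).hom := by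
  rw [← cancel_epi ((α_ U V W).hom ⊵ₗ m), MonoidalLeftAction.associator_actionHom,
    MonoidalLeftAction.hom_inv_actionHomLeft_assoc]

/-- The structure morphisms of a retract of a module functor with invertible structure morphisms
are invertible. -/
theorem isIso_c_of_retract {F G : ModEnd C M} (h : Retract F G) (X : C) (m : M)
    [IsIso (G.c X m)] : IsIso (F.c X m) := by
  -- The inverse for `G` is compressed to the retract; `comm` for `h.i` and `h.r` moves them past
  -- `c`.
  refine ⟨X ⊴ₗ h.i.trans.app m ≫ inv (G.c X m) ≫ h.r.trans.app (X ⊙ₗ m), ?_, ?_⟩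
  · rw [← Category.assoc, h.i.comm]
    simp [retract_app]
  · simp only [Category.assoc]
    rw [← h.r.comm, IsIso.inv_hom_id_assoc, ← MonoidalLeftAction.actionHomRight_comp, retract_app,
      MonoidalLeftAction.actionHomRight_id]

end

/-! ### Compatibility of `alpha` with unit and tensor product -/

section Alpha

variable {C : Type u₁} [Category.{v₁} C] [MonoidalCategory C]
  (M : Type u₂) [Category.{v₂} M] [Preadditive M] [MonoidalLeftAction C M]
  [∀ X : C, ((MonoidalLeftAction.curriedAction C M).obj X).Additive]

instance isIso_c_alpha_obj (b : BraidedCategory C) (X Y : C) (m : M) :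
    IsIso (((alpha M b).obj X).c Y m) :=
  inferInstanceAs (IsIso ((αₗ X Y m).inv ≫ (b.braiding X Y).hom ⊵ₗ m ≫ (αₗ Y X m).hom))

/-- `X ↦ X ⊙ₗ -` takes the unit object to the identity module functor. -/
def alphaUnitIso (b : BraidedCategory C) : 𝟙_ (ModEnd C M) ≅ (alpha M b).obj (𝟙_ C) :=
  mkIso (MonoidalLeftAction.actionUnitNatIso C M).symm fun X m => by
    change 𝟙 (X ⊙ₗ m) ≫ X ⊴ₗ (λₗ[C] m).inv = (λₗ[C] (X ⊙ₗ m)).inv ≫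
      (αₗ (𝟙_ C) X m).inv ≫ (b.braiding (𝟙_ C) X).hom ⊵ₗ m ≫ (αₗ X (𝟙_ C) m).hom
    rw [← cancel_mono (X ⊴ₗ (λₗ[C] m).hom)]
    have h := MonoidalLeftAction.rightUnitor_actionHom X m
    simp only [braiding_tensorUnit_left, Category.assoc, Category.id_comp,
      MonoidalLeftAction.comp_actionHomLeft, MonoidalLeftAction.leftUnitor_actionHom]
    rw [← h]
    simp only [MonoidalLeftAction.actionHomRight_inv_hom,
      MonoidalLeftAction.inv_hom_actionHomLeft, Iso.inv_hom_id_assoc]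

/-- `X ↦ X ⊙ₗ -` takes tensor products to compositions of module functors. -/
def alphaTensorIso (b : BraidedCategory C) (X Y : C) :
    (alpha M b).obj X ⊗ (alpha M b).obj Y ≅ (alpha M b).obj (X ⊗ Y) :=
  mkIso (F := (alpha M b).obj X ⊗ (alpha M b).obj Y)
    (G := (alpha M b).obj (X ⊗ Y))
    (NatIso.ofComponents (fun m => (αₗ X Y m).symm) fun f => by
      change X ⊴ₗ Y ⊴ₗ f ≫ (αₗ X Y _).inv = (αₗ X Y _).inv ≫ (X ⊗ Y) ⊴ₗ f
      simp) fun Z m => by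
    change (X ⊴ₗ ((αₗ Y Z m).inv ≫ (b.braiding Y Z).hom ⊵ₗ m ≫ (αₗ Z Y m).hom) ≫
        (αₗ X Z (Y ⊙ₗ m)).inv ≫ (b.braiding X Z).hom ⊵ₗ (Y ⊙ₗ m) ≫ (αₗ Z X (Y ⊙ₗ m)).hom) ≫
        Z ⊴ₗ (αₗ X Y m).inv =
      (αₗ X Y (Z ⊙ₗ m)).inv ≫ (αₗ (X ⊗ Y) Z m).inv ≫ (b.braiding (X ⊗ Y) Z).hom ⊵ₗ m ≫
        (αₗ Z (X ⊗ Y) m).hom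
    -- `h1`, `h2`, `h3` are the pentagon of the action, one for each associator in the hexagon
    -- expansion of the braiding of `X ⊗ Y` with `Z`.
    have h1 : (αₗ X Y (Z ⊙ₗ m)).inv ≫ (αₗ (X ⊗ Y) Z m).inv ≫ (α_ X Y Z).hom ⊵ₗ m =
        X ⊴ₗ (αₗ Y Z m).inv ≫ (αₗ X (Y ⊗ Z) m).inv := by
      rw [← cancel_mono ((αₗ X (Y ⊗ Z) m).hom ≫ X ⊴ₗ (αₗ Y Z m).hom)]
      simp
    have h2 : (αₗ X (Z ⊗ Y) m).inv ≫ (α_ X Z Y).inv ⊵ₗ m =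
        X ⊴ₗ (αₗ Z Y m).hom ≫ (αₗ X Z (Y ⊙ₗ m)).inv ≫ (αₗ (X ⊗ Z) Y m).inv := by
      rw [← cancel_mono ((αₗ (X ⊗ Z) Y m).hom ≫ (αₗ X Z (Y ⊙ₗ m)).hom)]
      simp [actionHomLeft_associator_inv]
    have h3 : (α_ Z X Y).hom ⊵ₗ m ≫ (αₗ Z (X ⊗ Y) m).hom =
        (αₗ (Z ⊗ X) Y m).hom ≫ (αₗ Z X (Y ⊙ₗ m)).hom ≫ Z ⊴ₗ (αₗ X Y m).inv := by
      rw [← cancel_mono (Z ⊴ₗ (αₗ X Y m).hom)]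
      simp
    simp only [BraidedCategory.braiding_tensor_left_hom,
      MonoidalLeftAction.comp_actionHomLeft, MonoidalLeftAction.whiskerLeft_actionHomLeft,
      MonoidalLeftAction.actionHomLeft_action, MonoidalLeftAction.actionHomRight_comp,
      Category.assoc]
    rw [h3, reassoc_of% h1]
    simp only [Iso.inv_hom_id_assoc]
    rw [reassoc_of% h2]

/-- The composition of retracts of `α X` and `α Y` is a retract of `α (X ⊗ Y)`. -/
def retractTensor (b : BraidedCategory C) {F G : ModEnd C M} {X Y : C}
    (h : Retract F ((alpha M b).obj X)) (k : Retract G ((alpha M b).obj Y)) :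
    Retract (F ⊗ G) ((alpha M b).obj (X ⊗ Y)) where
  i := (h.i ⊗ₘ k.i) ≫ (alphaTensorIso M b X Y).hom
  r := (alphaTensorIso M b X Y).inv ≫ (h.r ⊗ₘ k.r)
  retract := by simp

/-- The retracts of the module functors `X ⊙ₗ -` form a monoidal subcategory. -/
theorem isMonoidal_retracts_alpha (b : BraidedCategory C) :
    ObjectProperty.IsMonoidal
      (fun F : ModEnd C M => ∃ X : C, Nonempty (Retract F ((alpha M b).obj X))) where
  prop_unit := ⟨𝟙_ C, ⟨Retract.ofIso (alphaUnitIso M b)⟩⟩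
  prop_tensor := by
    rintro F G ⟨X, ⟨h⟩⟩ ⟨Y, ⟨k⟩⟩
    exact ⟨X ⊗ Y, ⟨retractTensor M b h k⟩⟩

end Alpha

/-! ### Structure morphisms as morphisms in `C*` -/

section

variable {C : Type u₁} [Category.{v₁} C] [MonoidalCategory C]
  {M : Type u₂} [Category.{v₂} M] [Preadditive M] [MonoidalLeftAction C M]
  [∀ X : C, ((MonoidalLeftAction.curriedAction C M).obj X).Additive]

/-- The structure morphisms of a module functor `F` form a morphism of module functors
`F ∘ (Y ⊙ₗ -) ⟶ (Y ⊙ₗ -) ∘ F`. -/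
def structureHom (F : ModEnd C M) (b : BraidedCategory C) (Y : C) :
    F ⊗ (alpha M b).obj Y ⟶ (alpha M b).obj Y ⊗ F where
  trans :=
    { app := fun m => F.c Y m
      naturality := fun _ _ f => F.c_naturality_right Y f }
  comm Z m := by
    change (F.functor.map ((αₗ Y Z m).inv ≫ (b.braiding Y Z).hom ⊵ₗ m ≫ (αₗ Z Y m).hom) ≫
        F.c Z (Y ⊙ₗ m)) ≫ Z ⊴ₗ F.c Y m =
      F.c Y (Z ⊙ₗ m) ≫ Y ⊴ₗ F.c Z m ≫ (αₗ Y Z (F.functor.obj m)).inv ≫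
        (b.braiding Y Z).hom ⊵ₗ F.functor.obj m ≫ (αₗ Z Y (F.functor.obj m)).hom
    -- Associativity of `c` merges the two structure morphisms into `F.c (Y ⊗ Z) m`; naturality in
    -- the `C`-variable then moves the braiding across, and associativity splits `F.c (Z ⊗ Y) m`
    -- again. Hence any braiding `b` works.
    have h : F.c Y (Z ⊙ₗ m) ≫ Y ⊴ₗ F.c Z m ≫ (αₗ Y Z (F.functor.obj m)).inv =
        F.functor.map (αₗ Y Z m).inv ≫ F.c (Y ⊗ Z) m := by
      rw [← cancel_mono (αₗ Y Z (F.functor.obj m)).hom]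
      simp only [Category.assoc, c_associativity, Iso.inv_hom_id, Category.comp_id]
      rw [← Functor.map_comp_assoc, Iso.inv_hom_id, CategoryTheory.Functor.map_id, Category.id_comp]
    rw [reassoc_of% h, ← reassoc_of% (F.c_naturality_left (b.braiding Y Z).hom m),
      c_associativity]
    simp only [Functor.map_comp, Category.assoc]

theorem whiskerRight_structureHom {F F' : ModEnd C M} (φ : F ⟶ F') (b : BraidedCategory C)
    (Y : C) :
    φ ▷ (alpha M b).obj Y ≫ F'.structureHom b Y = F.structureHom b Y ≫ (alpha M b).obj Y ◁ φ :=
  hom_ext fun m => (φ.comm Y m).symm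

/-- Source of `hexagon_reverse`: up to identities, this is the definition of `c` on a composite. -/
theorem structureHom_tensor (F F' : ModEnd C M) (b : BraidedCategory C) (Y : C) :
    (F ⊗ F').structureHom b Y =
      (α_ F F' ((alpha M b).obj Y)).hom ≫ F ◁ F'.structureHom b Y ≫
        (α_ F ((alpha M b).obj Y) F').inv ≫ F.structureHom b Y ▷ F' ≫
          (α_ ((alpha M b).obj Y) F F').hom :=
  hom_ext fun m => by
    change F.functor.map (F'.c Y m) ≫ F.c Y (F'.functor.obj m) =
      𝟙 _ ≫ F.functor.map (F'.c Y m) ≫ 𝟙 _ ≫ F.c Y (F'.functor.obj m) ≫ 𝟙 _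
    simp

/-- Source of `hexagon_forward`: this is the associativity axiom of `c`, with one associator moved
to the other side. -/
theorem whiskerLeft_alphaTensorIso_structureHom (F : ModEnd C M) (b : BraidedCategory C)
    (Y Z : C) :
    F ◁ (alphaTensorIso M b Y Z).hom ≫ F.structureHom b (Y ⊗ Z) =
      (α_ F ((alpha M b).obj Y) ((alpha M b).obj Z)).inv ≫ F.structureHom b Y ▷ (alpha M b).obj Z ≫
        (α_ ((alpha M b).obj Y) F ((alpha M b).obj Z)).hom ≫ (alpha M b).obj Y ◁ F.structureHom b Z ≫
          (α_ ((alpha M b).obj Y) ((alpha M b).obj Z) F).inv ≫ (alphaTensorIso M b Y Z).hom ▷ F :=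
  hom_ext fun m => by
    change F.functor.map (αₗ Y Z m).inv ≫ F.c (Y ⊗ Z) m =
      𝟙 _ ≫ F.c Y (Z ⊙ₗ m) ≫ 𝟙 _ ≫ Y ⊴ₗ F.c Z m ≫ 𝟙 _ ≫ (αₗ Y Z (F.functor.obj m)).inv
    rw [← cancel_mono (αₗ Y Z (F.functor.obj m)).hom]
    simp only [Category.assoc, c_associativity, Iso.inv_hom_id, Category.comp_id,
      Category.id_comp]
    rw [← Functor.map_comp_assoc, Iso.inv_hom_id, CategoryTheory.Functor.map_id, Category.id_comp]

end

/-! ### The relative braiding: construction, hexagons, uniqueness -/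

section Crossing

variable {C : Type u₁} [Category.{v₁} C] [MonoidalCategory C] [BraidedCategory C]
  {M : Type u₂} [Category.{v₂} M] [Preadditive M] [MonoidalLeftAction C M]
  [∀ X : C, ((MonoidalLeftAction.curriedAction C M).obj X).Additive]

theorem isIso_c_of_plus {F : ModEnd C M} (hF : plus C M F) (X : C) (m : M) :
    IsIso (F.c X m) := by
  obtain ⟨Z, ⟨h⟩⟩ := hF
  have : IsIso (((alphaPlus C M).obj Z).c X m) := isIso_c_alpha_obj M _ Z X m
  exact isIso_c_of_retract h X m

/-- For `F` in `C*₊`, the isomorphism of module functors `F ∘ α⁻ Y ≅ α⁻ Y ∘ F` given by the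
structure morphisms of `F`. -/
noncomputable def structureIso {F : ModEnd C M} (hF : plus C M F) (Y : C) :
    F ⊗ (alphaMinus C M).obj Y ≅ (alphaMinus C M).obj Y ⊗ F :=
  mkIso (F := F ⊗ (alphaMinus C M).obj Y) (G := (alphaMinus C M).obj Y ⊗ F)
    (NatIso.ofComponents (fun m => @asIso _ _ _ _ (F.c Y m) (isIso_c_of_plus hF Y m))
      fun f => F.c_naturality_right Y f)
    (F.structureHom (reverseBraiding C) Y).comm

/-- The only place where `α⁺` meets `α⁻`: their structure morphisms are mutually inverse, so the
square is `ψ.comm X` with its horizontal sides inverted. -/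
theorem whiskerLeft_structureHom_alphaPlus (X : C) {Y Z : C}
    (ψ : (alphaMinus C M).obj Y ⟶ (alphaMinus C M).obj Z) :
    (alphaPlus C M).obj X ◁ ψ ≫ ((alphaPlus C M).obj X).structureHom (reverseBraiding C) Z =
      ((alphaPlus C M).obj X).structureHom (reverseBraiding C) Y ≫ ψ ▷ (alphaPlus C M).obj X :=
  hom_ext fun m => by
    let e (V : C) : X ⊙ₗ V ⊙ₗ m ≅ V ⊙ₗ X ⊙ₗ m :=
      { hom := (αₗ X V m).inv ≫ (β_ X V).hom ⊵ₗ m ≫ (αₗ V X m).hom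
        inv := (αₗ V X m).inv ≫ (β_ X V).inv ⊵ₗ m ≫ (αₗ X V m).hom }
    have h : (e Y).inv ≫ X ⊴ₗ ψ.trans.app m = ψ.trans.app (X ⊙ₗ m) ≫ (e Z).inv :=
      ψ.comm X m
    exact (CommSq.mk (f := (e Y).symm.hom) (i := (e Z).symm.hom) h).horiz_inv.w.symm

theorem whiskerLeft_structureHom {F : ModEnd C M} (hF : plus C M F) {Y Z : C}
    (ψ : (alphaMinus C M).obj Y ⟶ (alphaMinus C M).obj Z) :
    F ◁ ψ ≫ F.structureHom (reverseBraiding C) Z =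
      F.structureHom (reverseBraiding C) Y ≫ ψ ▷ F := by
  obtain ⟨X, ⟨h⟩⟩ := hF
  have hi : ((alphaMinus C M).obj Z ◁ h.i) ≫ ((alphaMinus C M).obj Z ◁ h.r) = 𝟙 _ := by
    rw [← whiskerLeft_comp, h.retract, whiskerLeft_id]
  -- After cancelling this split mono, naturality in `F` along `h.i` reduces the claim to `α⁺ X`.
  have : IsSplitMono ((alphaMinus C M).obj Z ◁ h.i) := ⟨⟨⟨_, hi⟩⟩⟩
  rw [← cancel_mono ((alphaMinus C M).obj Z ◁ h.i), Category.assoc, Category.assoc,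
    ← whisker_exchange, ← whiskerRight_structureHom, ← reassoc_of% whiskerRight_structureHom,
    whisker_exchange_assoc, whiskerLeft_structureHom_alphaPlus]

/-- For `F` in `C*₊` and a retract `G` of `α⁻ Y`, the isomorphism `F ∘ G ≅ G ∘ F` obtained from
the structure morphisms of `F`. -/
noncomputable def crossing {F G : ModEnd C M} (hF : plus C M F) {Y : C}
    (h : Retract G ((alphaMinus C M).obj Y)) : F ⊗ G ≅ G ⊗ F where
  hom := F ◁ h.i ≫ (structureIso hF Y).hom ≫ h.r ▷ F
  inv := h.i ▷ F ≫ (structureIso hF Y).inv ≫ F ◁ h.r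
  hom_inv_id := by
    -- The structure isomorphism commutes with the idempotent `h.r ≫ h.i`, so its compression stays
    -- invertible.
    have e : F ◁ (h.r ≫ h.i) ≫ (structureIso hF Y).hom =
      (structureIso hF Y).hom ≫ (h.r ≫ h.i) ▷ F := whiskerLeft_structureHom hF (h.r ≫ h.i)
    rw [← Iso.eq_comp_inv] at e
    simp only [comp_whiskerRight, Category.assoc] at e
    simp only [Category.assoc, ← reassoc_of% e, ← whiskerLeft_comp]
    simp
  inv_hom_id := by
    have e : F ◁ (h.r ≫ h.i) ≫ (structureIso hF Y).hom =
      (structureIso hF Y).hom ≫ (h.r ≫ h.i) ▷ F := whiskerLeft_structureHom hF (h.r ≫ h.i)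
    rw [← Iso.inv_comp_eq] at e
    simp only [whiskerLeft_comp, Category.assoc] at e
    simp only [Category.assoc, reassoc_of% e, ← comp_whiskerRight]
    simp

theorem crossing_hom_app {F G : ModEnd C M} (hF : plus C M F) {Y : C}
    (h : Retract G ((alphaMinus C M).obj Y)) (m : M) :
    (crossing hF h).hom.trans.app m =
      F.functor.map (h.i.trans.app m) ≫ F.c Y m ≫ h.r.trans.app (F.functor.obj m) := rfl

theorem crossing_naturality_left {F F' G : ModEnd C M} (hF : plus C M F) (hF' : plus C M F')
    (φ : F ⟶ F') {Y : C} (h : Retract G ((alphaMinus C M).obj Y)) :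
    φ ▷ G ≫ (crossing hF' h).hom = (crossing hF h).hom ≫ G ◁ φ := by
  have e : φ ▷ (alphaMinus C M).obj Y ≫ (structureIso hF' Y).hom =
    (structureIso hF Y).hom ≫ (alphaMinus C M).obj Y ◁ φ := whiskerRight_structureHom φ _ Y
  simp only [crossing, Category.assoc]
  rw [← whisker_exchange_assoc, reassoc_of% e, whisker_exchange]

/-- Any `ψ` between retracts lifts to `h.r ≫ ψ ≫ h'.i` between `α⁻ Y` and `α⁻ Y'`, where
`whiskerLeft_structureHom` applies. The two presentations are unrelated, which gives independence of
the presentation when `ψ` is the identity. -/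
theorem crossing_naturality_right {F G G' : ModEnd C M} (hF : plus C M F) {Y Y' : C}
    (h : Retract G ((alphaMinus C M).obj Y)) (h' : Retract G' ((alphaMinus C M).obj Y'))
    (ψ : G ⟶ G') :
    F ◁ ψ ≫ (crossing hF h').hom = (crossing hF h).hom ≫ ψ ▷ F := by
  have e : F ◁ (h.r ≫ ψ ≫ h'.i) ≫ (structureIso hF Y').hom =
    (structureIso hF Y).hom ≫ (h.r ≫ ψ ≫ h'.i) ▷ F := whiskerLeft_structureHom hF _
  have e₁ : F ◁ ψ ≫ F ◁ h'.i = F ◁ h.i ≫ F ◁ (h.r ≫ ψ ≫ h'.i) := by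
    simp [← whiskerLeft_comp]
  have e₂ : h.r ▷ F ≫ ψ ▷ F = (h.r ≫ ψ ≫ h'.i) ▷ F ≫ h'.r ▷ F := by
    simp [← comp_whiskerRight]
  simp only [crossing, Category.assoc]
  rw [reassoc_of% e₁, reassoc_of% e, e₂]

/-- The isomorphism `crossing` does not depend on the presentation of `G` as a retract. -/
theorem crossing_eq {F G : ModEnd C M} (hF : plus C M F) {Y Y' : C}
    (h : Retract G ((alphaMinus C M).obj Y)) (h' : Retract G ((alphaMinus C M).obj Y')) :
    crossing hF h = crossing hF h' :=
  Iso.ext (by simpa using crossing_naturality_right hF h' h (𝟙 G))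

theorem crossing_hexagon_reverse {F F' G : ModEnd C M} (hF : plus C M F) (hF' : plus C M F')
    (hFF' : plus C M (F ⊗ F')) {Y : C} (h : Retract G ((alphaMinus C M).obj Y)) :
    (α_ F F' G).inv ≫ (crossing hFF' h).hom ≫ (α_ G F F').inv =
      F ◁ (crossing hF' h).hom ≫ (α_ F G F').inv ≫ (crossing hF h).hom ▷ F' := by
  have e : (structureIso hFF' Y).hom =
      (α_ F F' _).hom ≫ F ◁ (structureIso hF' Y).hom ≫ (α_ F _ F').inv ≫
        (structureIso hF Y).hom ▷ F' ≫ (α_ _ F F').hom := structureHom_tensor F F' _ Y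
  -- This absorbs the projection `h.r` left between the two successive crossings.
  have e₁ : F ◁ h.r ≫ (crossing hF h).hom = (structureIso hF Y).hom ≫ h.r ▷ F := by
    have e₂ := crossing_naturality_right hF (Retract.refl _) h h.r
    simpa [crossing] using e₂
  have e₂ : F ◁ (crossing hF' h).hom =
    F ◁ F' ◁ h.i ≫ F ◁ (structureIso hF' Y).hom ≫ F ◁ h.r ▷ F' := by simp [crossing]
  rw [e₂]
  simp only [Category.assoc]
  rw [associator_inv_naturality_middle_assoc, ← comp_whiskerRight, e₁]
  simp [crossing, e]

theorem crossing_hexagon_forward {F G G' : ModEnd C M} (hF : plus C M F) {Y Y' : C}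
    (h : Retract G ((alphaMinus C M).obj Y)) (h' : Retract G' ((alphaMinus C M).obj Y')) :
    (α_ F G G').hom ≫ (crossing hF (retractTensor M _ h h')).hom ≫ (α_ G G' F).hom =
      (crossing hF h).hom ▷ G' ≫ (α_ G F G').hom ≫ G ◁ (crossing hF h').hom := by
  have e : F ◁ (alphaTensorIso M (reverseBraiding C) Y Y').hom ≫ (structureIso hF (Y ⊗ Y')).hom =
      (α_ F _ _).inv ≫ (structureIso hF Y).hom ▷ _ ≫ (α_ _ F _).hom ≫
        _ ◁ (structureIso hF Y').hom ≫ (α_ _ _ F).inv ≫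
          (alphaTensorIso M (reverseBraiding C) Y Y').hom ▷ F :=
    whiskerLeft_alphaTensorIso_structureHom F _ Y Y'
  simp only [crossing, retractTensor, whiskerLeft_comp, comp_whiskerRight, Category.assoc]
  rw [reassoc_of% e, tensorHom_def h.i h'.i, tensorHom_def' h.r h'.r]
  simp only [whiskerLeft_comp, comp_whiskerRight, Category.assoc, hom_inv_whiskerRight_assoc,
    whisker_assoc, associator_inv_naturality_right_assoc, associator_naturality_left,
    associator_naturality_left_assoc, Iso.inv_hom_id_assoc]
  -- Interchange separates the maps acting on the `G` factor from those acting on the `G'` factor.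
  rw [whisker_exchange_assoc (structureIso hF Y).hom h'.i,
    ← whisker_exchange_assoc h.r (F ◁ h'.i), ← whisker_exchange_assoc h.r (structureIso hF Y').hom,
    ← whisker_exchange h.r (h'.r ▷ F)]
  simp

/-- The functorial family of isomorphisms `F ∘ G ≅ G ∘ F`, for `F` in `C*₊` and `G` in `C*₋`. -/
noncomputable def relativeBraiding : RelativeBraiding (plus C M) (minus C M) where
  -- The chosen presentation of `G` is immaterial by `crossing_eq`.
  iso hF hG := crossing hF hG.choose_spec.some
  naturality_left hF hF' _ φ := crossing_naturality_left hF hF' φ _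
  naturality_right hF _ _ ψ := crossing_naturality_right hF _ _ ψ

theorem relativeBraiding_iso_eq {F G : ModEnd C M} (hF : plus C M F) (hG : minus C M G) {Y : C}
    (h : Retract G ((alphaMinus C M).obj Y)) :
    relativeBraiding.iso hF hG = crossing hF h :=
  crossing_eq hF _ h

theorem relativeBraiding_extends : (relativeBraiding (C := C) (M := M)).Extends := by
  intro X Y m
  rw [relativeBraiding_iso_eq _ _ (Retract.refl _), crossing_hom_app]
  change X ⊴ₗ 𝟙 (Y ⊙ₗ m) ≫ ((αₗ X Y m).inv ≫ (β_ X Y).hom ⊵ₗ m ≫ (αₗ Y X m).hom) ≫ 𝟙 _ = _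
  simp

theorem relativeBraiding_isMultiplicative :
    (relativeBraiding (C := C) (M := M)).IsMultiplicative where
  hexagon_forward hF hG hG' hGG' := by
    obtain ⟨Y, ⟨h⟩⟩ := id hG
    obtain ⟨Y', ⟨h'⟩⟩ := id hG'
    rw [relativeBraiding_iso_eq hF hG h, relativeBraiding_iso_eq hF hG' h',
      relativeBraiding_iso_eq hF hGG' (retractTensor M _ h h'), crossing_hexagon_forward]
  hexagon_reverse hF hF' hFF' hG := crossing_hexagon_reverse hF hF' hFF' _

/-- A relative braiding between `C*₊` and `C*₋` is determined by its values on the `α⁺ X` and the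
`α⁻ Y`. -/
theorem relativeBraiding_ext_of_extends {b b' : RelativeBraiding (plus C M) (minus C M)}
    (hb : b.Extends) (hb' : b'.Extends) : b = b' := by
  have key {F G : ModEnd C M} (hF : plus C M F) (hG : minus C M G) :
      b.iso hF hG = b'.iso hF hG := by
    obtain ⟨X, ⟨h⟩⟩ := id hF
    obtain ⟨Y, ⟨k⟩⟩ := id hG
    have e : b.iso (plus_alphaPlus M X) (minus_alphaMinus M Y) =
        b'.iso (plus_alphaPlus M X) (minus_alphaMinus M Y) :=
      Iso.ext (hom_ext fun m => (hb X Y m).trans (hb' X Y m).symm)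
    -- Inserting `i ≫ r = 𝟙` in both variables and applying naturality leaves only the value on `α⁺
    -- X` and `α⁻ Y`.
    have formula (b : RelativeBraiding (plus C M) (minus C M)) : (b.iso hF hG).hom =
        h.i ▷ G ≫ (alphaPlus C M).obj X ◁ k.i ≫
          (b.iso (plus_alphaPlus M X) (minus_alphaMinus M Y)).hom ≫
            k.r ▷ (alphaPlus C M).obj X ≫ G ◁ h.r := by
      rw [reassoc_of% b.naturality_right (plus_alphaPlus M X) hG (minus_alphaMinus M Y) k.i,
        ← comp_whiskerRight_assoc, k.retract, id_whiskerRight, Category.id_comp,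
        ← b.naturality_left (plus_alphaPlus M X) hF hG h.r, ← comp_whiskerRight_assoc, h.retract,
        id_whiskerRight, Category.id_comp]
    exact Iso.ext (by rw [formula b, formula b', e])
  cases b
  cases b'
  congr
  funext F G hF hG
  exact key hF hG

end Crossing

end ModEnd

/-- A multiplicative relative braiding between monoidal subcategories restricts to a braiding on
their intersection. -/
abbrev RelativeBraiding.IsMultiplicative.braidedCategory {D : Type u₁} [Category.{v₁} D]
    [MonoidalCategory D] {P Q : ObjectProperty D} {b : RelativeBraiding P Q}
    (hb : b.IsMultiplicative) [(P ⊓ Q).IsMonoidal] :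
    BraidedCategory (P ⊓ Q).FullSubcategory where
  -- The left factor is used as an object of `P`, the right one as an object of `Q`.
  braiding F G := (P ⊓ Q).isoMk (b.iso F.property.1 G.property.2)
  braiding_naturality_right F _ _ ψ :=
    ObjectProperty.hom_ext _ (b.naturality_right F.property.1 _ _ ψ.hom)
  braiding_naturality_left φ G :=
    ObjectProperty.hom_ext _ (b.naturality_left _ _ G.property.2 φ.hom)
  hexagon_forward F G H := ObjectProperty.hom_ext _
    (hb.hexagon_forward F.property.1 G.property.2 H.property.2 (G ⊗ H).property.2)
  hexagon_reverse F G H := ObjectProperty.hom_ext _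
    (hb.hexagon_reverse F.property.1 G.property.1 (F ⊗ G).property.1 H.property.2)

theorem proposition4 {C : Type u₁} [Category.{v₁} C] [MonoidalCategory C] [BraidedCategory C]
    {M : Type u₂} [Category.{v₂} M] [Preadditive M] [MonoidalLeftAction C M]
    [∀ X : C, ((MonoidalLeftAction.curriedAction C M).obj X).Additive] :
    (ModEnd.plus C M).IsMonoidal ∧ (ModEnd.minus C M).IsMonoidal ∧
    ∃ b : RelativeBraiding (ModEnd.plus C M) (ModEnd.minus C M),
      b.Extends ∧
      (∀ b' : RelativeBraiding (ModEnd.plus C M) (ModEnd.minus C M), b'.Extends → b' = b) ∧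
      b.IsMultiplicative ∧
      ∃ _ : (ModEnd.plus C M ⊓ ModEnd.minus C M).IsMonoidal,
      ∃ B : BraidedCategory (ModEnd.plus C M ⊓ ModEnd.minus C M).FullSubcategory,
        ∀ F G : (ModEnd.plus C M ⊓ ModEnd.minus C M).FullSubcategory,
          (B.braiding F G).hom.hom = (b.iso F.property.1 G.property.2).hom := by
  -- The same lemma serves twice, for the braiding of `C` and for its reverse.
  have hp : (ModEnd.plus C M).IsMonoidal := ModEnd.isMonoidal_retracts_alpha M _
  have hm : (ModEnd.minus C M).IsMonoidal := ModEnd.isMonoidal_retracts_alpha M _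
  have hpm : (ModEnd.plus C M ⊓ ModEnd.minus C M).IsMonoidal :=
    { prop_unit := ⟨hp.prop_unit, hm.prop_unit⟩
      prop_tensor := fun F G hF hG =>
        ⟨hp.prop_tensor F G hF.1 hG.1, hm.prop_tensor F G hF.2 hG.2⟩ }
  exact ⟨hp, hm, ModEnd.relativeBraiding, ModEnd.relativeBraiding_extends,
    fun _ hb' => ModEnd.relativeBraiding_ext_of_extends hb' ModEnd.relativeBraiding_extends,
    ModEnd.relativeBraiding_isMultiplicative, hpm,
    ModEnd.relativeBraiding_isMultiplicative.braidedCategory, fun _ _ => rfl⟩
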